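/- For a complex number $x$ and an integer $j\ge 0$ let $\binom{x}{j}=\frac{x(x-1)\cdots(x-j+1)}{j!}$, and for a complex number $z$ that is not a negative integer let $z!=\Gamma(z+1)$. Theorem. Let $a$ be a nonnegative integer and let $m$ be a complex number. If $a$ is odd, then $$\det_{0\le i,j\le a-1}\left(-\delta_{ij}+\binom{m+i+j}{j}\right)=0.$$ If $a$ is even and $m$ is not a negative integer (in particular, if $m$ is a nonnegative integer), then $$\det_{0\le i,j\le a-1}\left(-\delta_{ij}+\binom{m+i+j}{j}\right)=(-1)^{a/2}\prod_{i=0}^{a/2-1}\frac{i!^2\,\left(\frac m2+i\right)!^2\,\left(\frac m2+3i+1\right)!^2\,(m+3i+1)!^2}{(2i)!\,(2i+1)!\,\left(\frac m2+2i\right)!^2\,\left(\frac m2+2i+1\right)!^2\,(m+2i)!\,(m+2i+1)!}.$$ Here the determinant of the empty matrix ($a=0$) and the empty product are $1$. -/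

import Mathlib

/-- The factorial `z! = Γ(z + 1)` of a complex number `z`. At a natural number it is the usual
factorial; it is meaningful whenever `z` is not a negative integer. -/
noncomputable def complexFactorial (z : ℂ) : ℂ := Complex.Gamma (z + 1)

open Matrix

/-! Write `P m` for `pascalInvolution a m`. Vandermonde convolution gives `P m * P m = 1`, and it
shows that the binomial matrix is `(P 0)ᵀ * P m`. Hence the matrix of the theorem is `((P 0)ᵀ - P m)
* P m`, whose last factor has determinant ±1. Conjugation by the two involutions sends `J = (P 0)ᵀ -
P m` to `-J`, so `det J = 0` when `a` is odd.

For `a = 2n`, a diagonal matrix `D` of Gamma quotients satisfies `P 0 * D = D * P m`. Then `J * D⁻¹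
= (P 0)ᵀ * D⁻¹ - D⁻¹ * P 0` is skew-symmetric. In a basis of eigenvectors of `P 0`, the blocks
pairing equal eigenvalues vanish, and what remains is twice the n × n pairing of the two
eigenspaces, together with its negative transpose (`pascalEigenrows_mul_mul_transpose`). So `det J`
is a square up to explicit factors (`det_sub_pascalInvolution_of_even`).

The eigenvectors are chosen so that each pairing entry is again a Vandermonde sum. Up to row and
column factors it is a product of three Pochhammer symbols (`pascalPairing_apply`), whose
determinant is a product (`det_ascPochhammer`). That evaluation is proved by Dodgson condensation at
generic parameters and extended by continuity. -/

/-! ### Dodgson condensation and a skew block determinant. -/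

theorem Matrix.det_toBlocks₂₂_adjugate_mul_det {R m n : Type*} [CommRing R] [Fintype m]
    [DecidableEq m] [Fintype n] [DecidableEq n] (M : Matrix (m ⊕ n) (m ⊕ n) R) :
    M.det * M.adjugate.toBlocks₂₂.det = M.toBlocks₁₁.det * M.det ^ Fintype.card n := by
  have h : fromBlocks M.toBlocks₁₁ M.toBlocks₁₂ M.toBlocks₂₁ M.toBlocks₂₂ *
      fromBlocks M.adjugate.toBlocks₁₁ M.adjugate.toBlocks₁₂ M.adjugate.toBlocks₂₁
        M.adjugate.toBlocks₂₂ = M.det • (1 : Matrix (m ⊕ n) (m ⊕ n) R) := by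
    rw [fromBlocks_toBlocks, fromBlocks_toBlocks, mul_adjugate]
  rw [fromBlocks_multiply, ← fromBlocks_one, fromBlocks_smul, fromBlocks_inj] at h
  obtain ⟨-, h12, -, h22⟩ := h
  -- Replacing the first block column of the adjugate by that of the identity makes both sides block
  -- triangular.
  have key : M * fromBlocks 1 M.adjugate.toBlocks₁₂ 0 M.adjugate.toBlocks₂₂ =
      fromBlocks M.toBlocks₁₁ 0 M.toBlocks₂₁ (M.det • (1 : Matrix n n R)) := by
    nth_rw 1 [← fromBlocks_toBlocks M]
    rw [fromBlocks_multiply, h12, h22]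
    simp
  have := congrArg det key
  rw [det_mul, det_fromBlocks_zero₂₁, det_fromBlocks_zero₁₂, det_one, one_mul, det_smul, det_one,
    mul_one] at this
  exact this

/-- Jacobi's complementary minor identity. One factor `M.det` has to be cancelled, which is
legitimate for the generic matrix over `ℤ`; the result then specializes to every commutative ring.
-/
theorem Matrix.det_toBlocks₂₂_adjugate {R m : Type*} [CommRing R] [Fintype m]
    [DecidableEq m] (M : Matrix (m ⊕ Fin 2) (m ⊕ Fin 2) R) :
    M.adjugate.toBlocks₂₂.det = M.toBlocks₁₁.det * M.det := by
  let A' := mvPolynomialX (m ⊕ Fin 2) (m ⊕ Fin 2) ℤ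
  suffices h : A'.adjugate.toBlocks₂₂.det = A'.toBlocks₁₁.det * A'.det by
    have := congrArg (MvPolynomial.aeval fun ij : (m ⊕ Fin 2) × (m ⊕ Fin 2) => M ij.1 ij.2) h
    have hM : A'.map (MvPolynomial.aeval fun ij : (m ⊕ Fin 2) × (m ⊕ Fin 2) => M ij.1 ij.2) = M := by
      simpa using mvPolynomialX_mapMatrix_aeval ℤ M
    rw [map_mul, AlgHom.map_det, AlgHom.map_det, AlgHom.map_det] at this
    have h1 : ∀ B : Matrix (m ⊕ Fin 2) (m ⊕ Fin 2) (MvPolynomial _ ℤ),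
        (MvPolynomial.aeval fun ij : (m ⊕ Fin 2) × (m ⊕ Fin 2) => M ij.1 ij.2).mapMatrix
          B.toBlocks₂₂ = ((MvPolynomial.aeval fun ij : (m ⊕ Fin 2) × (m ⊕ Fin 2) =>
            M ij.1 ij.2).mapMatrix B).toBlocks₂₂ := fun B => rfl
    have h2 : ∀ B : Matrix (m ⊕ Fin 2) (m ⊕ Fin 2) (MvPolynomial _ ℤ),
        (MvPolynomial.aeval fun ij : (m ⊕ Fin 2) × (m ⊕ Fin 2) => M ij.1 ij.2).mapMatrix
          B.toBlocks₁₁ = ((MvPolynomial.aeval fun ij : (m ⊕ Fin 2) × (m ⊕ Fin 2) =>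
            M ij.1 ij.2).mapMatrix B).toBlocks₁₁ := fun B => rfl
    rw [h1, h2, AlgHom.map_adjugate, AlgHom.mapMatrix_apply, hM] at this
    exact this
  have h0 : A'.det ≠ 0 := det_mvPolynomialX_ne_zero _ ℤ
  apply mul_left_cancel₀ h0
  rw [det_toBlocks₂₂_adjugate_mul_det]
  simp
  ring

/-- Dodgson condensation, also known as the Desnanot–Jacobi identity. -/
theorem Matrix.det_mul_det_interior {R : Type*} [CommRing R] {n : ℕ}
    (M : Matrix (Fin (n + 2)) (Fin (n + 2)) R) :
    M.det * (M.submatrix (fun i : Fin n => i.castSucc.succ) fun j : Fin n => j.castSucc.succ).det =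
      (M.submatrix Fin.castSucc Fin.castSucc).det * (M.submatrix Fin.succ Fin.succ).det -
        (M.submatrix Fin.succ Fin.castSucc).det * (M.submatrix Fin.castSucc Fin.succ).det := by
  -- Interior indices go to the first block and the two extreme indices to the second, so that
  -- Jacobi's 2 × 2 minor consists of the four corners of the adjugate.
  let f : Fin n ⊕ Fin 2 → Fin (n + 2) :=
    Sum.elim (fun i => i.castSucc.succ) ![0, Fin.last (n + 1)]
  have hf : Function.Injective f := by
    rintro (i | i) (j | j) h
    · simpa [f] using h
    · fin_cases j <;> simp [f, Fin.ext_iff] at h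
      omega
    · fin_cases i <;> simp [f, Fin.ext_iff] at h
      omega
    · fin_cases i <;> fin_cases j <;> simp [f, Fin.ext_iff] at h ⊢
  let e : Fin n ⊕ Fin 2 ≃ Fin (n + 2) :=
    Equiv.ofBijective f ((Fintype.bijective_iff_injective_and_card f).2 ⟨hf, by simp⟩)
  have h := det_toBlocks₂₂_adjugate (M.submatrix e e)
  rw [adjugate_submatrix_equiv_self, det_submatrix_equiv_self, det_fin_two] at h
  have e0 : e (Sum.inr 0) = 0 := rfl
  have e1 : e (Sum.inr 1) = Fin.last (n + 1) := rfl
  have h11 : (M.submatrix e e).toBlocks₁₁ =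
    M.submatrix (fun i : Fin n => i.castSucc.succ) fun j : Fin n => j.castSucc.succ := rfl
  simp only [toBlocks₂₂, of_apply, submatrix_apply, e0, e1, h11,
    adjugate_fin_succ_eq_det_submatrix, Fin.succAbove_zero, Fin.succAbove_last] at h
  rw [mul_comm, ← h]
  simp only [Fin.val_zero, Fin.val_last, zero_add, add_zero, pow_zero]
  have hs : ((-1 : R) ^ (n + 1)) * (-1) ^ (n + 1) = 1 := by rw [← mul_pow]; simp
  rw [pow_add, hs]
  linear_combination (-(M.submatrix Fin.succ Fin.castSucc).det *
    (M.submatrix Fin.castSucc Fin.succ).det) * hs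

theorem Matrix.det_fromBlocks_zero_neg_transpose {R n : Type*} [CommRing R] [Fintype n]
    [DecidableEq n] (B : Matrix n n R) : (fromBlocks 0 B (-Bᵀ) 0).det = B.det ^ 2 := by
  have h1 : fromBlocks 0 B (-Bᵀ) 0 =
      fromBlocks B 0 0 Bᵀ * fromBlocks (0 : Matrix n n R) 1 (-1) 0 := by
    simp [fromBlocks_multiply]
  -- A unimodular shear shows that the standard symplectic matrix has determinant 1, with no sign
  -- depending on the size.
  have h2 : fromBlocks (0 : Matrix n n R) 1 (-1) 0 *
      fromBlocks (1 : Matrix n n R) (-1 : Matrix n n R) 0 (1 : Matrix n n R) =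
      fromBlocks 0 1 (-1) 1 := by simp [fromBlocks_multiply]
  have h3 := congrArg det h2
  rw [det_mul, det_fromBlocks_zero₂₁, det_fromBlocks_one₂₂] at h3
  simp at h3
  rw [h1, det_mul, det_fromBlocks_zero₂₁, h3, det_transpose, mul_one, sq]

/-! ### A two-parameter determinant evaluated by condensation. -/

/-- The matrix entries `(x+y+i+j-1)! / ((x+2i-j)! (y+2j-i)!)`. -/
noncomputable def gammaEntry (x y : ℂ) (i j : ℕ) : ℂ :=
  Complex.Gamma (x + y + i + j) /
    (Complex.Gamma (x + 2 * i - j + 1) * Complex.Gamma (y + 2 * j - i + 1))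

/-- The factors of the determinant of the matrix with entries `gammaEntry x y i j`. -/
noncomputable def gammaFactor (x y : ℂ) (i : ℕ) : ℂ :=
  (i.factorial : ℂ) * Complex.Gamma (x + y + i) *
      ((ascPochhammer ℂ i).eval (2 * x + y + 2 * i) *
        (ascPochhammer ℂ i).eval (x + 2 * y + 2 * i)) /
    (Complex.Gamma (x + 2 * i + 1) * Complex.Gamma (y + 2 * i + 1))

/-- No pole or zero of the factors in the determinant evaluation passes through `(x, y)`. -/
structure IsGenericPair (x y : ℂ) : Prop where
  left : ∀ k : ℤ, x ≠ k
  right : ∀ k : ℤ, y ≠ k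
  add : ∀ k : ℤ, x + y ≠ k
  two_mul_add : ∀ k : ℤ, 2 * x + y ≠ k
  add_two_mul : ∀ k : ℤ, x + 2 * y ≠ k

theorem IsGenericPair.shift {x y : ℂ} (h : IsGenericPair x y) (p q : ℤ) :
    IsGenericPair (x + p) (y + q) where
  left k hk := h.left (k - p) (by push_cast; linear_combination hk)
  right k hk := h.right (k - q) (by push_cast; linear_combination hk)
  add k hk := h.add (k - p - q) (by push_cast; linear_combination hk)
  two_mul_add k hk := h.two_mul_add (k - 2 * p - q) (by push_cast; linear_combination hk)
  add_two_mul k hk := h.add_two_mul (k - p - 2 * q) (by push_cast; linear_combination hk)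

theorem add_intCast_ne_zero_of_forall_ne {z : ℂ} (h : ∀ k : ℤ, z ≠ k) (n : ℤ) : z + n ≠ 0 :=
  fun hz => h (-n) (by push_cast; linear_combination hz)

theorem Complex.Gamma_add_intCast_ne_zero {z : ℂ} (h : ∀ k : ℤ, z ≠ k) (n : ℤ) :
    Complex.Gamma (z + n) ≠ 0 :=
  Complex.Gamma_ne_zero fun m hm => h (-m - n) (by push_cast; linear_combination hm)

theorem ascPochhammer_eval_ne_zero {z : ℂ} (n : ℕ) (h : ∀ k : ℕ, z + k ≠ 0) :
    (ascPochhammer ℂ n).eval z ≠ 0 := by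
  induction n with
  | zero => simp
  | succ n ih => rw [ascPochhammer_succ_eval]; exact mul_ne_zero ih (h n)

theorem Complex.Gamma_mul_ascPochhammer_eval {z : ℂ} (n : ℕ) (h : ∀ k : ℕ, z + k ≠ 0) :
    Complex.Gamma z * (ascPochhammer ℂ n).eval z = Complex.Gamma (z + n) := by
  induction n with
  | zero => simp
  | succ n ih =>
    rw [ascPochhammer_succ_eval, ← mul_assoc, ih, Nat.cast_succ, ← add_assoc,
      Complex.Gamma_add_one _ (h n), mul_comm]

theorem gammaFactor_ne_zero {x y : ℂ} (h : IsGenericPair x y) (i : ℕ) : gammaFactor x y i ≠ 0 := by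
  have h1 := Complex.Gamma_add_intCast_ne_zero h.add i
  have h2 := Complex.Gamma_add_intCast_ne_zero h.left (2 * i + 1)
  have h3 := Complex.Gamma_add_intCast_ne_zero h.right (2 * i + 1)
  push_cast [← add_assoc] at h1 h2 h3
  have h4 : (ascPochhammer ℂ i).eval (2 * x + y + 2 * i) ≠ 0 :=
    ascPochhammer_eval_ne_zero _ fun k => by
      have := add_intCast_ne_zero_of_forall_ne h.two_mul_add (2 * i + k)
      push_cast [← add_assoc] at this
      exact this
  have h5 : (ascPochhammer ℂ i).eval (x + 2 * y + 2 * i) ≠ 0 :=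
    ascPochhammer_eval_ne_zero _ fun k => by
      have := add_intCast_ne_zero_of_forall_ne h.add_two_mul (2 * i + k)
      push_cast [← add_assoc] at this
      exact this
  have h6 : (i.factorial : ℂ) ≠ 0 := Nat.cast_ne_zero.2 i.factorial_ne_zero
  unfold gammaFactor
  positivity

theorem gammaFactor_cross_shift {x y : ℂ} (h : IsGenericPair x y) (N : ℕ) :
    gammaFactor (x + 2) (y - 1) N * gammaFactor (x - 1) (y + 2) N *
        ((x + y + N + 1) * (x + 2 * N + 2) * (y + 2 * N + 2)) =
      gammaFactor x y N * gammaFactor (x + 1) (y + 1) N *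
        ((x + y + N) * (x + 2 * N) * (y + 2 * N)) := by
  have hx := fun k => add_intCast_ne_zero_of_forall_ne h.left k
  have hy := fun k => add_intCast_ne_zero_of_forall_ne h.right k
  have x0 := hx (2 * N)
  have x1 := hx (2 * N + 1)
  have x2 := hx (2 * N + 2)
  have y0 := hy (2 * N)
  have y1 := hy (2 * N + 1)
  have y2 := hy (2 * N + 2)
  have s0 := add_intCast_ne_zero_of_forall_ne h.add N
  have s1 := add_intCast_ne_zero_of_forall_ne h.add (N + 1)
  have gx := Complex.Gamma_add_intCast_ne_zero h.left (2 * N)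
  have gy := Complex.Gamma_add_intCast_ne_zero h.right (2 * N)
  push_cast [← add_assoc] at x0 x1 x2 y0 y1 y2 s0 s1 gx gy
  unfold gammaFactor
  have e1 : x + 2 + (y - 1) + (N : ℂ) = x + y + N + 1 := by ring
  have e2 : x - 1 + (y + 2) + (N : ℂ) = x + y + N + 1 := by ring
  have e3 : x + 1 + (y + 1) + (N : ℂ) = x + y + N + 1 + 1 := by ring
  have e4 : 2 * (x + 2) + (y - 1) + 2 * (N : ℂ) = 2 * (x + 1) + (y + 1) + 2 * N := by ring
  have e5 : x + 2 + 2 * (y - 1) + 2 * (N : ℂ) = x + 2 * y + 2 * N := by ring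
  have e6 : 2 * (x - 1) + (y + 2) + 2 * (N : ℂ) = 2 * x + y + 2 * N := by ring
  have e7 : x - 1 + 2 * (y + 2) + 2 * (N : ℂ) = x + 1 + 2 * (y + 1) + 2 * N := by ring
  have e8 : x + 2 + 2 * (N : ℂ) + 1 = x + 2 * N + 1 + 1 + 1 := by ring
  have e9 : y + 2 + 2 * (N : ℂ) + 1 = y + 2 * N + 1 + 1 + 1 := by ring
  have e10 : x - 1 + 2 * (N : ℂ) + 1 = x + 2 * N := by ring
  have e11 : y - 1 + 2 * (N : ℂ) + 1 = y + 2 * N := by ring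
  have e12 : x + 1 + 2 * (N : ℂ) + 1 = x + 2 * N + 1 + 1 := by ring
  have e13 : y + 1 + 2 * (N : ℂ) + 1 = y + 2 * N + 1 + 1 := by ring
  have x2' : x + 2 * (N : ℂ) + 1 + 1 ≠ 0 := by
    rw [add_assoc]; norm_num; exact x2
  have y2' : y + 2 * (N : ℂ) + 1 + 1 ≠ 0 := by
    rw [add_assoc]; norm_num; exact y2
  rw [e1, e2, e3, e4, e5, e6, e7, e8, e9, e10, e11, e12, e13, Complex.Gamma_add_one _ s1,
    Complex.Gamma_add_one _ s0, Complex.Gamma_add_one _ x2', Complex.Gamma_add_one _ x1,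
    Complex.Gamma_add_one _ x0, Complex.Gamma_add_one _ y2', Complex.Gamma_add_one _ y1,
    Complex.Gamma_add_one _ y0]
  generalize (ascPochhammer ℂ N).eval (2 * (x + 1) + (y + 1) + 2 * (N : ℂ)) = a₁
  generalize (ascPochhammer ℂ N).eval (x + 1 + 2 * (y + 1) + 2 * (N : ℂ)) = a₂
  generalize (ascPochhammer ℂ N).eval (2 * x + y + 2 * (N : ℂ)) = a₃
  generalize (ascPochhammer ℂ N).eval (x + 2 * y + 2 * (N : ℂ)) = a₄
  clear e1 e2 e3 e4 e5 e6 e7 e8 e9 e10 e11 e12 e13 hx hy h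
  generalize Complex.Gamma (x + y + (N : ℂ)) = gs
  generalize x + y + (N : ℂ) = s at *
  generalize x + 2 * (N : ℂ) = u at *
  generalize y + 2 * (N : ℂ) = v at *
  generalize Complex.Gamma u = gu at *
  generalize Complex.Gamma v = gv at *
  generalize (N.factorial : ℂ) = f
  rw [show u + 1 + 1 = u + 2 by ring, show v + 1 + 1 = v + 2 by ring]
  rw [div_mul_div_comm, div_mul_eq_mul_div, div_mul_div_comm, div_mul_eq_mul_div,
    div_eq_div_iff (by positivity) (by positivity)]
  ring

/-- The ratio of the two products occurring in condensation telescopes, each step being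
`gammaFactor_cross_shift`. -/
theorem prod_gammaFactor_cross_shift {x y : ℂ} (h : IsGenericPair x y) (N : ℕ) :
    (∏ i ∈ Finset.range N, gammaFactor (x + 2) (y - 1) i) *
        (∏ i ∈ Finset.range N, gammaFactor (x - 1) (y + 2) i) *
        ((x + y + N) * (x + 2 * N) * (y + 2 * N)) =
      (∏ i ∈ Finset.range N, gammaFactor x y i) *
        (∏ i ∈ Finset.range N, gammaFactor (x + 1) (y + 1) i) * ((x + y) * x * y) := by
  induction N with
  | zero => simp
  | succ N ih =>
    have hN := gammaFactor_cross_shift h N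
    simp only [Finset.prod_range_succ]
    push_cast
    linear_combination (∏ i ∈ Finset.range N, gammaFactor (x + 2) (y - 1) i) *
      (∏ i ∈ Finset.range N, gammaFactor (x - 1) (y + 2) i) * hN +
      gammaFactor x y N * gammaFactor (x + 1) (y + 1) N * ih

theorem gammaFactor_succ {x y : ℂ} (h : IsGenericPair x y) (n : ℕ) :
    gammaFactor x y (n + 1) *
        ((x + y + (n + 1)) * (x + 2 * (n + 1)) * (y + 2 * (n + 1))) =
      gammaFactor (x + 1) (y + 1) n *
        ((n + 1) * (2 * x + y + 2 * (n + 1)) * (x + 2 * y + 2 * (n + 1))) := by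
  have x1 := add_intCast_ne_zero_of_forall_ne h.left (2 * n + 2)
  have y1 := add_intCast_ne_zero_of_forall_ne h.right (2 * n + 2)
  have s0 := add_intCast_ne_zero_of_forall_ne h.add (n + 1)
  have gx := Complex.Gamma_add_intCast_ne_zero h.left (2 * n + 2)
  have gy := Complex.Gamma_add_intCast_ne_zero h.right (2 * n + 2)
  push_cast at x1 y1 s0 gx gy
  unfold gammaFactor
  have e1 : x + 1 + (y + 1) + (n : ℂ) = x + y + (n + 1) + 1 := by ring
  have e2 : x + 1 + 2 * (n : ℂ) + 1 = x + (2 * n + 2) := by ring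
  have e3 : y + 1 + 2 * (n : ℂ) + 1 = y + (2 * n + 2) := by ring
  have e4 : x + 2 * ((n : ℂ) + 1) = x + (2 * n + 2) := by ring
  have e5 : y + 2 * ((n : ℂ) + 1) = y + (2 * n + 2) := by ring
  have e6 : 2 * (x + 1) + (y + 1) + 2 * (n : ℂ) = 2 * x + y + 2 * (n + 1) + 1 := by ring
  have e7 : x + 1 + 2 * (y + 1) + 2 * (n : ℂ) = x + 2 * y + 2 * (n + 1) + 1 := by ring
  have asc : ∀ z : ℂ, (ascPochhammer ℂ (n + 1)).eval z = z * (ascPochhammer ℂ n).eval (z + 1) := by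
    intro z
    rw [ascPochhammer_succ_left, Polynomial.eval_mul, Polynomial.eval_X, Polynomial.eval_comp]
    simp
  push_cast
  rw [e1, e2, e3, e4, e5, e6, e7, asc, asc, Complex.Gamma_add_one _ s0, Complex.Gamma_add_one _ x1,
    Complex.Gamma_add_one _ y1, Nat.factorial_succ]
  push_cast
  generalize x + (2 * (n : ℂ) + 2) = u at *
  generalize y + (2 * (n : ℂ) + 2) = v at *
  generalize Complex.Gamma u = gu at *
  generalize Complex.Gamma v = gv at *
  generalize (ascPochhammer ℂ n).eval (2 * x + y + 2 * ((n : ℂ) + 1) + 1) = a₁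
  generalize (ascPochhammer ℂ n).eval (x + 2 * y + 2 * ((n : ℂ) + 1) + 1) = a₂
  field_simp

/-- After division by common factors, with `N = n + 1`, this is the cubic identity
`(x+y+N)(x+2N)(y+2N) - (x+y)xy = N(2x+y+2N)(x+2y+2N)`. -/
theorem prod_gammaFactor_condensation {x y : ℂ} (h : IsGenericPair x y) (n : ℕ) :
    (∏ i ∈ Finset.range (n + 2), gammaFactor x y i) *
        (∏ i ∈ Finset.range n, gammaFactor (x + 1) (y + 1) i) =
      (∏ i ∈ Finset.range (n + 1), gammaFactor x y i) *
          (∏ i ∈ Finset.range (n + 1), gammaFactor (x + 1) (y + 1) i) -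
        (∏ i ∈ Finset.range (n + 1), gammaFactor (x + 2) (y - 1) i) *
          (∏ i ∈ Finset.range (n + 1), gammaFactor (x - 1) (y + 2) i) := by
  have x1 := add_intCast_ne_zero_of_forall_ne h.left (2 * (n + 1))
  have y1 := add_intCast_ne_zero_of_forall_ne h.right (2 * (n + 1))
  have s0 := add_intCast_ne_zero_of_forall_ne h.add (n + 1)
  push_cast at x1 y1 s0
  have h1 := prod_gammaFactor_cross_shift h (n + 1)
  have h2 := gammaFactor_succ h n
  push_cast at h1
  apply mul_right_cancel₀ (mul_ne_zero (mul_ne_zero s0 x1) y1)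
  rw [sub_mul, h1, Finset.prod_range_succ _ (n + 1),
    Finset.prod_range_succ (fun i => gammaFactor (x + 1) (y + 1) i) n]
  linear_combination (∏ i ∈ Finset.range (n + 1), gammaFactor x y i) *
    (∏ i ∈ Finset.range n, gammaFactor (x + 1) (y + 1) i) * h2

/-- The family is closed under condensation: deleting a first row or column only shifts `(x, y)` by
integers. Genericity makes the interior minor nonzero, so it can be cancelled. -/
theorem det_gammaEntry : ∀ (n : ℕ) {x y : ℂ}, IsGenericPair x y →
    det (of fun i j : Fin n => gammaEntry x y i j) = ∏ i ∈ Finset.range n, gammaFactor x y i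
  | 0, x, y, _ => by simp
  | 1, x, y, _ => by simp [gammaEntry, gammaFactor]
  | n + 2, x, y, h => by
    have h11 : IsGenericPair (x + 1) (y + 1) := by simpa using h.shift 1 1
    have h21 : IsGenericPair (x + 2) (y - 1) := by simpa [sub_eq_add_neg] using h.shift 2 (-1)
    have h12 : IsGenericPair (x - 1) (y + 2) := by simpa [sub_eq_add_neg] using h.shift (-1) 2
    have hd := det_mul_det_interior (of fun i j : Fin (n + 2) => gammaEntry x y i j)
    have a1 : (of fun i j : Fin (n + 2) => gammaEntry x y i j).submatrix
        (fun i : Fin n => i.castSucc.succ) (fun j : Fin n => j.castSucc.succ) =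
        of fun i j : Fin n => gammaEntry (x + 1) (y + 1) i j := by
      ext i j
      simp only [submatrix_apply, of_apply, gammaEntry, Fin.val_succ, Fin.val_castSucc]
      push_cast
      exact congrArg₂ _ (congrArg _ (by ring))
        (congrArg₂ _ (congrArg _ (by ring)) (congrArg _ (by ring)))
    have a2 : (of fun i j : Fin (n + 2) => gammaEntry x y i j).submatrix Fin.succ Fin.succ =
        of fun i j : Fin (n + 1) => gammaEntry (x + 1) (y + 1) i j := by
      ext i j
      simp only [submatrix_apply, of_apply, gammaEntry, Fin.val_succ]
      push_cast
      exact congrArg₂ _ (congrArg _ (by ring))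
        (congrArg₂ _ (congrArg _ (by ring)) (congrArg _ (by ring)))
    have a3 : (of fun i j : Fin (n + 2) => gammaEntry x y i j).submatrix Fin.succ Fin.castSucc =
        of fun i j : Fin (n + 1) => gammaEntry (x + 2) (y - 1) i j := by
      ext i j
      simp only [submatrix_apply, of_apply, gammaEntry, Fin.val_succ, Fin.val_castSucc]
      push_cast
      exact congrArg₂ _ (congrArg _ (by ring))
        (congrArg₂ _ (congrArg _ (by ring)) (congrArg _ (by ring)))
    have a4 : (of fun i j : Fin (n + 2) => gammaEntry x y i j).submatrix Fin.castSucc Fin.succ =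
        of fun i j : Fin (n + 1) => gammaEntry (x - 1) (y + 2) i j := by
      ext i j
      simp only [submatrix_apply, of_apply, gammaEntry, Fin.val_succ, Fin.val_castSucc]
      push_cast
      exact congrArg₂ _ (congrArg _ (by ring))
        (congrArg₂ _ (congrArg _ (by ring)) (congrArg _ (by ring)))
    have a5 : (of fun i j : Fin (n + 2) => gammaEntry x y i j).submatrix
        Fin.castSucc Fin.castSucc = of fun i j : Fin (n + 1) => gammaEntry x y i j := rfl
    rw [a1, a2, a3, a4, a5, det_gammaEntry n h11, det_gammaEntry (n + 1) h11,
      det_gammaEntry (n + 1) h21, det_gammaEntry (n + 1) h12, det_gammaEntry (n + 1) h,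
      ← prod_gammaFactor_condensation h] at hd
    exact mul_right_cancel₀
      (Finset.prod_ne_zero_iff.2 fun i _ => gammaFactor_ne_zero h11 i) hd

theorem det_ascPochhammer_of_isGenericPair (n : ℕ) {x y : ℂ} (h : IsGenericPair x y) :
    det (of fun i j : Fin n => (ascPochhammer ℂ j).eval (x + y + (i : ℕ)) *
        (ascPochhammer ℂ j).eval (x + 2 * (i : ℕ) - (j : ℕ) + 1) *
        (ascPochhammer ℂ i).eval (y + 2 * (j : ℕ) - (i : ℕ) + 1)) =
      ∏ i ∈ Finset.range n, (i.factorial : ℂ) * ((ascPochhammer ℂ i).eval (2 * x + y + 2 * i) *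
        (ascPochhammer ℂ i).eval (x + 2 * y + 2 * i)) := by
  have hg := det_gammaEntry n h
  have hs : ∀ i : ℕ, Complex.Gamma (x + y + i) ≠ 0 := fun i => by
    simpa using Complex.Gamma_add_intCast_ne_zero h.add i
  have hx : ∀ i : ℕ, Complex.Gamma (x + 2 * i + 1) ≠ 0 := fun i => by
    simpa [add_assoc] using Complex.Gamma_add_intCast_ne_zero h.left (2 * i + 1)
  have hy : ∀ i : ℕ, Complex.Gamma (y + 2 * i + 1) ≠ 0 := fun i => by
    simpa [add_assoc] using Complex.Gamma_add_intCast_ne_zero h.right (2 * i + 1)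
  -- Row and column scalings turn the Gamma quotients into polynomials in `x` and `y`.
  have hentry : (of fun i j : Fin n => (ascPochhammer ℂ j).eval (x + y + (i : ℕ)) *
        (ascPochhammer ℂ j).eval (x + 2 * (i : ℕ) - (j : ℕ) + 1) *
        (ascPochhammer ℂ i).eval (y + 2 * (j : ℕ) - (i : ℕ) + 1)) =
      of fun i j : Fin n => Complex.Gamma (x + 2 * (i : ℕ) + 1) / Complex.Gamma (x + y + (i : ℕ)) *
        (of fun i j : Fin n => Complex.Gamma (y + 2 * (j : ℕ) + 1) *
          (of fun i j : Fin n => gammaEntry x y i j) i j) i j := by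
    ext i j
    have g1 := Complex.Gamma_mul_ascPochhammer_eval (z := x + y + (i : ℕ)) j fun k => by
      have := add_intCast_ne_zero_of_forall_ne h.add ((i : ℕ) + k)
      push_cast [← add_assoc] at this
      exact this
    have g2 := Complex.Gamma_mul_ascPochhammer_eval (z := x + 2 * (i : ℕ) - (j : ℕ) + 1) j
      fun k hk => h.left (-2 * (i : ℕ) + (j : ℕ) - 1 - k) (by push_cast; linear_combination hk)
    have g3 := Complex.Gamma_mul_ascPochhammer_eval (z := y + 2 * (j : ℕ) - (i : ℕ) + 1) i
      fun k hk => h.right (-2 * (j : ℕ) + (i : ℕ) - 1 - k) (by push_cast; linear_combination hk)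
    rw [show x + 2 * ((i : ℕ) : ℂ) - (j : ℕ) + 1 + (j : ℕ) = x + 2 * (i : ℕ) + 1 by ring] at g2
    rw [show y + 2 * ((j : ℕ) : ℂ) - (i : ℕ) + 1 + (i : ℕ) = y + 2 * (j : ℕ) + 1 by ring] at g3
    have n2 : Complex.Gamma (x + 2 * (i : ℕ) - (j : ℕ) + 1) ≠ 0 :=
      fun h0 => hx i (by rw [← g2, h0, zero_mul])
    have n3 : Complex.Gamma (y + 2 * (j : ℕ) - (i : ℕ) + 1) ≠ 0 :=
      fun h0 => hy j (by rw [← g3, h0, zero_mul])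
    simp only [of_apply, gammaEntry]
    rw [← g1, ← g2, ← g3]
    have := hs i
    generalize Complex.Gamma (x + 2 * ((i : ℕ) : ℂ) - (j : ℕ) + 1) = gx at *
    generalize Complex.Gamma (y + 2 * ((j : ℕ) : ℂ) - (i : ℕ) + 1) = gy at *
    field_simp
  rw [hentry, det_mul_column, det_mul_row, hg,
    Finset.prod_range fun i => gammaFactor x y i, Finset.prod_range, ← Finset.prod_mul_distrib,
    ← Finset.prod_mul_distrib]
  refine Finset.prod_congr rfl fun i _ => ?_
  have h1 := hs i
  have h2 := hx i
  have h3 := hy i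
  unfold gammaFactor
  field_simp

theorem det_ascPochhammer (n : ℕ) (x y : ℂ) :
    det (of fun i j : Fin n => (ascPochhammer ℂ j).eval (x + y + (i : ℕ)) *
        (ascPochhammer ℂ j).eval (x + 2 * (i : ℕ) - (j : ℕ) + 1) *
        (ascPochhammer ℂ i).eval (y + 2 * (j : ℕ) - (i : ℕ) + 1)) =
      ∏ i ∈ Finset.range n, (i.factorial : ℂ) * ((ascPochhammer ℂ i).eval (2 * x + y + 2 * i) *
        (ascPochhammer ℂ i).eval (x + 2 * y + 2 * i)) := by
  -- Along the line `(x + t, y + t)` each excluded linear form takes a given integer value only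
  -- once, so the bad set is countable and its complement dense.
  let S : Set ℂ := {t | ¬ IsGenericPair (x + t) (y + t)}
  have hS : S.Countable := by
    have : S ⊆ Set.range (fun k : ℤ => (k : ℂ) - x) ∪ Set.range (fun k : ℤ => (k : ℂ) - y) ∪
        Set.range (fun k : ℤ => ((k : ℂ) - (x + y)) / 2) ∪
        Set.range (fun k : ℤ => ((k : ℂ) - (2 * x + y)) / 3) ∪
        Set.range (fun k : ℤ => ((k : ℂ) - (x + 2 * y)) / 3) := by
      intro t ht
      by_contra hn
      simp only [Set.mem_union, Set.mem_range, not_or, not_exists] at hn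
      obtain ⟨⟨⟨⟨h1, h2⟩, h3⟩, h4⟩, h5⟩ := hn
      exact ht ⟨fun k hk => h1 k (by linear_combination -hk),
        fun k hk => h2 k (by linear_combination -hk),
        fun k hk => h3 k (by linear_combination -hk / 2),
        fun k hk => h4 k (by linear_combination -hk / 3),
        fun k hk => h5 k (by linear_combination -hk / 3)⟩
    refine Set.Countable.mono this ?_
    simp only [Set.countable_union, Set.countable_range, and_self]
  have hdense : Dense Sᶜ := hS.dense_compl ℂ
  have hc : ∀ (k : ℕ) (f : ℂ → ℂ), Continuous f →
      Continuous fun t => (ascPochhammer ℂ k).eval (f t) :=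
    fun k f hf => (ascPochhammer ℂ k).continuous.comp hf
  have key := Continuous.ext_on hdense
    (f := fun t : ℂ => det (of fun i j : Fin n =>
      (ascPochhammer ℂ j).eval ((x + t) + (y + t) + (i : ℕ)) *
        (ascPochhammer ℂ j).eval ((x + t) + 2 * (i : ℕ) - (j : ℕ) + 1) *
        (ascPochhammer ℂ i).eval ((y + t) + 2 * (j : ℕ) - (i : ℕ) + 1)))
    (g := fun t : ℂ => ∏ i ∈ Finset.range n, (i.factorial : ℂ) *
      ((ascPochhammer ℂ i).eval (2 * (x + t) + (y + t) + 2 * i) *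
        (ascPochhammer ℂ i).eval ((x + t) + 2 * (y + t) + 2 * i)))
    (by
      refine Continuous.matrix_det (continuous_matrix fun i j => ?_)
      exact ((hc _ _ (by fun_prop)).mul (hc _ _ (by fun_prop))).mul (hc _ _ (by fun_prop)))
    (by
      refine continuous_finsetProd _ fun i _ => continuous_const.mul ?_
      exact (hc _ _ (by fun_prop)).mul (hc _ _ (by fun_prop)))
    (fun t ht => det_ascPochhammer_of_isGenericPair n (not_not.1 ht))
  simpa using congrFun key 0

/-! ### Pascal involutions, factorization of the matrix, and the odd case. -/

/-- The coefficient of `X ^ l` in the power series `X ^ j * (1 - X) ^ r`. -/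
noncomputable def shiftedCoeff (r : ℂ) (l j : ℕ) : ℂ :=
  if j ≤ l then (-1) ^ (l - j) * Ring.choose r (l - j) else 0

theorem shiftedCoeff_add_left (r : ℂ) (j k : ℕ) :
    shiftedCoeff r (j + k) j = (-1) ^ k * Ring.choose r k := by
  simp [shiftedCoeff]

theorem shiftedCoeff_of_lt {r : ℂ} {l j : ℕ} (h : l < j) : shiftedCoeff r l j = 0 :=
  if_neg (not_le.2 h)

theorem shiftedCoeff_self (r : ℂ) (l : ℕ) : shiftedCoeff r l l = 1 := by
  simp [shiftedCoeff]

theorem shiftedCoeff_zero (l j : ℕ) : shiftedCoeff 0 l j = if l = j then 1 else 0 := by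
  rcases lt_trichotomy l j with h | rfl | h
  · rw [shiftedCoeff_of_lt h, if_neg h.ne]
  · simp [shiftedCoeff_self]
  · rw [shiftedCoeff, if_pos h.le, Ring.choose_zero_pos _ (by omega), if_neg h.ne', mul_zero]

/-- Chu–Vandermonde, that is, `(1 - X) ^ r * (1 - X) ^ s = (1 - X) ^ (r + s)`. Terms with `j > l`
vanish, so `l < a` ensures that the truncation loses nothing. -/
theorem sum_shiftedCoeff_mul_shiftedCoeff {a l : ℕ} (hl : l < a) (r s : ℂ) (i : ℕ) :
    ∑ j : Fin a, shiftedCoeff r j i * shiftedCoeff s l j = shiftedCoeff (r + s) l i := by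
  rw [Fin.sum_univ_eq_sum_range (fun j => shiftedCoeff r j i * shiftedCoeff s l j)]
  have hsub : Finset.Ico i (l + 1) ⊆ Finset.range a := fun j hj => by
    rw [Finset.mem_Ico] at hj
    rw [Finset.mem_range]
    omega
  rw [← Finset.sum_subset hsub fun j _ hj => ?_]
  · rcases lt_or_ge l i with h | h
    · rw [Finset.Ico_eq_empty (by omega), Finset.sum_empty, shiftedCoeff_of_lt h]
    · obtain ⟨k, rfl⟩ := Nat.exists_eq_add_of_le h
      rw [Finset.sum_Ico_eq_sum_range, shiftedCoeff_add_left,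
        Ring.add_choose_eq k (Commute.all r s), Finset.Nat.sum_antidiagonal_eq_sum_range_succ_mk,
        Finset.mul_sum, show i + k + 1 - i = k.succ by omega]
      refine Finset.sum_congr rfl fun j hj => ?_
      obtain ⟨b, rfl⟩ := Nat.exists_eq_add_of_le (Nat.lt_succ_iff.1 (Finset.mem_range.1 hj))
      rw [shiftedCoeff_add_left, ← add_assoc, shiftedCoeff_add_left, Nat.add_sub_cancel_left,
        pow_add]
      ring
  · rw [Finset.mem_Ico, not_and_or] at hj
    rcases hj with hj | hj
    · rw [shiftedCoeff_of_lt (by omega), zero_mul]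
    · rw [shiftedCoeff_of_lt (r := s) (by omega), mul_zero]

theorem Ring.choose_upper_neg (r : ℂ) (n : ℕ) :
    Ring.choose r n = (-1) ^ n * Ring.choose (n - 1 - r) n := by
  have h := Ring.choose_neg (-r) n
  rw [neg_neg, Int.negOnePow_def, show -r + (n : ℂ) - 1 = n - 1 - r by ring] at h
  rw [h, Units.smul_def]
  simp

theorem shiftedCoeff_upper_neg (r : ℂ) (l i : ℕ) :
    shiftedCoeff r l i = (-1) ^ (l + i) * shiftedCoeff (l - i - 1 - r) l i := by
  rcases lt_or_ge l i with h | h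
  · rw [shiftedCoeff_of_lt h, shiftedCoeff_of_lt h, mul_zero]
  · obtain ⟨k, rfl⟩ := Nat.exists_eq_add_of_le h
    rw [shiftedCoeff_add_left, shiftedCoeff_add_left, Ring.choose_upper_neg]
    push_cast
    rw [show (i : ℂ) + k - i - 1 - r = k - 1 - r by ring, show i + k + i = k + 2 * i by ring,
      pow_add, pow_mul]
    simp

/-- The matrix of `f(X) ↦ (1 - X) ^ (-m - 1) * f(X / (X - 1))` acting on power series modulo
`X ^ a`. -/
noncomputable def pascalInvolution (a : ℕ) (m : ℂ) : Matrix (Fin a) (Fin a) ℂ :=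
  of fun i j => (-1) ^ (j : ℕ) * shiftedCoeff (m + (j : ℕ)) j i

/-- Upper negation moves the varying part of the exponent from the column index to the row index, so
that applying a row to a vector becomes a Vandermonde convolution. -/
theorem pascalInvolution_apply (a : ℕ) (m : ℂ) (i j : Fin a) :
    pascalInvolution a m i j = (-1) ^ (i : ℕ) * shiftedCoeff (-m - 1 - (i : ℕ)) j i := by
  have h : ((-1 : ℂ) ^ (j : ℕ)) * (-1) ^ (j : ℕ) = 1 := by rw [← mul_pow]; simp
  rw [pascalInvolution, of_apply, shiftedCoeff_upper_neg, pow_add, ← mul_assoc, ← mul_assoc, h,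
    one_mul]
  congr 2
  ring

/-- The reflection `b ↦ l + m - b` is the source of the eigenvectors: its fixed points and its orbit
sums are eigenvectors with eigenvalue `(-1) ^ l`. -/
theorem pascalInvolution_mulVec_shiftedCoeff {a l : ℕ} (hl : l < a) (m b : ℂ) :
    pascalInvolution a m *ᵥ (fun j : Fin a => shiftedCoeff b l j) =
      fun j : Fin a => (-1) ^ l * shiftedCoeff (l + m - b) l j := by
  ext i
  have h : ((-1 : ℂ) ^ (i : ℕ)) * (-1) ^ (i : ℕ) = 1 := by rw [← mul_pow]; simp
  simp only [mulVec, dotProduct, pascalInvolution_apply, mul_assoc]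
  rw [← Finset.mul_sum, sum_shiftedCoeff_mul_shiftedCoeff hl, shiftedCoeff_upper_neg, pow_add,
    mul_comm ((-1 : ℂ) ^ l), ← mul_assoc, ← mul_assoc, h, one_mul]
  congr 2
  ring

theorem pascalInvolution_mul_self (a : ℕ) (m : ℂ) :
    pascalInvolution a m * pascalInvolution a m = 1 := by
  ext i k
  have h : ((-1 : ℂ) ^ (k : ℕ)) * (-1) ^ (k : ℕ) = 1 := by rw [← mul_pow]; simp
  -- Column `k` is, up to sign, the vector with `b = m + k`, which is reflected to `b = 0`, a unit
  -- vector.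
  have hk := congrFun (pascalInvolution_mulVec_shiftedCoeff k.isLt m (m + (k : ℕ))) i
  have : (pascalInvolution a m * pascalInvolution a m) i k =
      (-1) ^ (k : ℕ) * (pascalInvolution a m *ᵥ
        (fun j : Fin a => shiftedCoeff (m + (k : ℕ)) k j)) i := by
    simp only [mul_apply, mulVec, dotProduct, Finset.mul_sum]
    refine Finset.sum_congr rfl fun j _ => ?_
    rw [show pascalInvolution a m j k = (-1) ^ (k : ℕ) * shiftedCoeff (m + (k : ℕ)) k j from rfl]
    ring
  rw [this, hk, ← mul_assoc, h, one_mul, show ((k : ℕ) : ℂ) + m - (m + (k : ℕ)) = 0 by ring,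
    shiftedCoeff_zero, one_apply]
  simp [Fin.ext_iff, eq_comm]

theorem pascalInvolution_zero_apply (a : ℕ) (i j : Fin a) :
    pascalInvolution a 0 i j = shiftedCoeff (j : ℕ) i 0 := by
  have h0 := shiftedCoeff_add_left (j : ℕ) 0 i
  rw [zero_add] at h0
  rw [h0, pascalInvolution, of_apply, zero_add, Ring.choose_natCast]
  rcases lt_or_ge (j : ℕ) (i : ℕ) with h | h
  · rw [shiftedCoeff_of_lt h, Nat.choose_eq_zero_of_lt h]
    simp
  · obtain ⟨k, hk⟩ := Nat.exists_eq_add_of_le h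
    rw [hk, shiftedCoeff_add_left, Ring.choose_natCast, ← Nat.choose_symm_add, pow_add, mul_assoc,
      ← mul_assoc ((-1 : ℂ) ^ k), ← mul_pow]
    simp

theorem transpose_pascalInvolution_mul_pascalInvolution (a : ℕ) (m : ℂ) :
    (pascalInvolution a 0)ᵀ * pascalInvolution a m =
      of fun i j : Fin a => Ring.choose (m + ((i : ℕ) : ℂ) + ((j : ℕ) : ℂ)) (j : ℕ) := by
  ext i j
  simp only [mul_apply, transpose_apply, of_apply, pascalInvolution_zero_apply]
  have h : ((-1 : ℂ) ^ (j : ℕ)) * (-1) ^ (j : ℕ) = 1 := by rw [← mul_pow]; simp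
  have h0 := shiftedCoeff_add_left ((i : ℕ) + (m + (j : ℕ))) 0 j
  rw [zero_add] at h0
  simp only [pascalInvolution, of_apply, mul_left_comm _ ((-1 : ℂ) ^ (j : ℕ))]
  rw [← Finset.mul_sum, sum_shiftedCoeff_mul_shiftedCoeff j.isLt, h0, ← mul_assoc, h, one_mul]
  congr 1
  ring

theorem det_pascalInvolution (a : ℕ) (m : ℂ) :
    (pascalInvolution a m).det = ∏ i : Fin a, (-1) ^ (i : ℕ) := by
  rw [det_of_isUpperTriangular]
  · refine Finset.prod_congr rfl fun i _ => ?_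
    simp [pascalInvolution, shiftedCoeff_self]
  · intro i j hij
    have hij : (j : ℕ) < i := hij
    simp only [pascalInvolution, of_apply]
    rw [shiftedCoeff_of_lt hij, mul_zero]

theorem prod_neg_one_pow_sq (a : ℕ) :
    (∏ i : Fin a, (-1 : ℂ) ^ (i : ℕ)) * ∏ i : Fin a, (-1 : ℂ) ^ (i : ℕ) = 1 := by
  rw [← Finset.prod_mul_distrib]
  exact Finset.prod_eq_one fun i _ => by rw [← mul_pow]; simp

theorem det_neg_one_add_choose (a : ℕ) (m : ℂ) :
    det (of fun i j : Fin a => -(if i = j then (1 : ℂ) else 0) +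
        Ring.choose (m + ((i : ℕ) : ℂ) + ((j : ℕ) : ℂ)) (j : ℕ)) =
      det ((pascalInvolution a 0)ᵀ - pascalInvolution a m) * ∏ i : Fin a, (-1 : ℂ) ^ (i : ℕ) := by
  rw [← det_pascalInvolution a m, ← det_mul, sub_mul, pascalInvolution_mul_self,
    transpose_pascalInvolution_mul_pascalInvolution]
  congr 1
  ext i j
  simp only [of_apply, Matrix.sub_apply, one_apply]
  ring

theorem det_sub_pascalInvolution_of_odd {a : ℕ} (ha : Odd a) (m : ℂ) :
    det ((pascalInvolution a 0)ᵀ - pascalInvolution a m) = 0 := by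
  have h : (pascalInvolution a 0)ᵀ * ((pascalInvolution a 0)ᵀ - pascalInvolution a m) *
      pascalInvolution a m = -((pascalInvolution a 0)ᵀ - pascalInvolution a m) := by
    rw [mul_sub, sub_mul, ← transpose_mul, pascalInvolution_mul_self, mul_assoc,
      pascalInvolution_mul_self]
    simp
  have hd := congrArg det h
  rw [det_mul, det_mul, det_transpose, det_pascalInvolution, det_pascalInvolution, det_neg,
    Fintype.card_fin, ha.neg_one_pow, mul_right_comm, prod_neg_one_pow_sq] at hd
  linear_combination hd / 2

/-! ### Pochhammer and binomial identities. -/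

theorem ascPochhammer_eval_add (z : ℂ) (i k : ℕ) :
    (ascPochhammer ℂ (i + k)).eval z =
      (ascPochhammer ℂ i).eval z * (ascPochhammer ℂ k).eval (z + i) := by
  rw [← ascPochhammer_mul, Polynomial.eval_mul, Polynomial.eval_comp]
  simp

theorem factorial_mul_choose_add (z : ℂ) (k : ℕ) :
    (k.factorial : ℂ) * Ring.choose (z + k) k = (ascPochhammer ℂ k).eval (z + 1) := by
  have h := Ring.factorial_nsmul_multichoose_eq_ascPochhammer (z + 1) k
  rw [Polynomial.ascPochhammer_smeval_eq_eval, Ring.multichoose_eq, nsmul_eq_mul] at h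
  rw [← h]
  congr 2
  ring

/-- Formally both sides are `Γ(z+r) Γ(z+s) / Γ(z)`; this form stays valid when `z` itself is a pole.
-/
theorem ascPochhammer_eval_mul_Gamma_comm {z : ℂ} {r s : ℕ} (hr : ∀ k : ℕ, z + r + k ≠ 0)
    (hs : ∀ k : ℕ, z + s + k ≠ 0) :
    (ascPochhammer ℂ r).eval z * Complex.Gamma (z + s) =
      (ascPochhammer ℂ s).eval z * Complex.Gamma (z + r) := by
  rcases le_total s r with h | h
  · obtain ⟨k, rfl⟩ := Nat.exists_eq_add_of_le h
    have := Complex.Gamma_mul_ascPochhammer_eval k hs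
    rw [ascPochhammer_eval_add, Nat.cast_add, ← add_assoc, ← this]
    ring
  · obtain ⟨k, rfl⟩ := Nat.exists_eq_add_of_le h
    have := Complex.Gamma_mul_ascPochhammer_eval k hr
    rw [ascPochhammer_eval_add, Nat.cast_add, ← add_assoc, ← this]
    ring

theorem factorial_mul_choose_add_choose (z : ℂ) (r : ℕ) :
    (z + r) * ((r.factorial : ℂ) * (Ring.choose (z + r - 1) r + Ring.choose (z + r) r)) =
      (2 * z + r) * (ascPochhammer ℂ r).eval (z + 1) := by
  have h1 := factorial_mul_choose_add (z - 1) r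
  have h2 := factorial_mul_choose_add z r
  rw [show z - 1 + (r : ℂ) = z + r - 1 by ring, sub_add_cancel] at h1
  have h3 : (ascPochhammer ℂ r).eval z * (z + r) = z * (ascPochhammer ℂ r).eval (z + 1) := by
    rw [← ascPochhammer_succ_eval, ascPochhammer_succ_left, Polynomial.eval_mul,
      Polynomial.eval_X, Polynomial.eval_comp]
    simp
  linear_combination (z + r) * h1 + (z + r) * h2 + h3

/-! ### Diagonal conjugation, eigenvectors and their pairing. -/

/-- The weights that conjugate `pascalInvolution a m` to `pascalInvolution a 0`. -/
noncomputable def pascalWeight (m : ℂ) (j : ℕ) : ℂ := Complex.Gamma (m + j + 1) / j.factorial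

theorem pascalWeight_ne_zero {m : ℂ} (hm : ∀ k : ℕ, m ≠ -((k : ℂ) + 1)) (j : ℕ) :
    pascalWeight m j ≠ 0 :=
  div_ne_zero (Complex.Gamma_ne_zero fun k hk => hm (j + k) (by
    push_cast; linear_combination hk)) (Nat.cast_ne_zero.2 j.factorial_ne_zero)

theorem shiftedCoeff_mul_pascalWeight {m : ℂ} (hm : ∀ k : ℕ, m ≠ -((k : ℂ) + 1)) (i j : ℕ) :
    shiftedCoeff j j i * pascalWeight m j = pascalWeight m i * shiftedCoeff (m + j) j i := by
  rcases lt_or_ge j i with h | h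
  · rw [shiftedCoeff_of_lt h, shiftedCoeff_of_lt h, zero_mul, mul_zero]
  · obtain ⟨k, rfl⟩ := Nat.exists_eq_add_of_le h
    have h1 := factorial_mul_choose_add (m + i) k
    have h2 := Complex.Gamma_mul_ascPochhammer_eval (z := m + i + 1) k
      fun t ht => hm (i + t) (by push_cast; linear_combination ht)
    have h3 : ((i + k).choose k : ℂ) * (k.factorial * i.factorial) = (i + k).factorial := by
      have := Nat.add_choose_mul_factorial_mul_factorial i k
      rw [← this]
      push_cast
      ring
    rw [shiftedCoeff_add_left, shiftedCoeff_add_left, Ring.choose_natCast, pascalWeight,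
      pascalWeight]
    rw [show m + (i : ℂ) + 1 + k = m + i + k + 1 by ring, ← h1] at h2
    push_cast
    rw [← add_assoc, ← h2, ← h3]
    have hi : (i.factorial : ℂ) ≠ 0 := Nat.cast_ne_zero.2 i.factorial_ne_zero
    have hk : (k.factorial : ℂ) ≠ 0 := Nat.cast_ne_zero.2 k.factorial_ne_zero
    have hc : ((i + k).choose k : ℂ) ≠ 0 :=
      Nat.cast_ne_zero.2 (Nat.choose_pos (Nat.le_add_left k i)).ne'
    field_simp

theorem pascalInvolution_zero_mul_diagonal {m : ℂ} (hm : ∀ k : ℕ, m ≠ -((k : ℂ) + 1)) (a : ℕ) :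
    pascalInvolution a 0 * diagonal (fun j : Fin a => pascalWeight m j) =
      diagonal (fun j : Fin a => pascalWeight m j) * pascalInvolution a m := by
  ext i j
  rw [mul_diagonal, diagonal_mul, pascalInvolution, pascalInvolution, of_apply, of_apply, zero_add,
    mul_assoc, shiftedCoeff_mul_pascalWeight hm]
  ring

/-- `(1 - X) ^ k` is palindromic up to sign. The right side is the fixed point `b = k` of the
reflection with `l = 2k`, `m = 0`; the left side starts at `j = k` and suits the pairing. -/
theorem shiftedCoeff_natCast_symm (k j : ℕ) :
    shiftedCoeff k j k = (-1) ^ k * shiftedCoeff k (2 * k) j := by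
  rcases lt_or_ge j k with h | h
  · rw [shiftedCoeff_of_lt h, shiftedCoeff, if_pos (by omega), Ring.choose_natCast,
      Nat.choose_eq_zero_of_lt (by omega)]
    simp
  rcases lt_or_ge (2 * k) j with h' | h'
  · rw [shiftedCoeff_of_lt h', shiftedCoeff, if_pos h, Ring.choose_natCast,
      Nat.choose_eq_zero_of_lt (by omega)]
    simp
  · rw [shiftedCoeff, shiftedCoeff, if_pos h, if_pos h', Ring.choose_natCast, Ring.choose_natCast,
      ← Nat.choose_symm (show j - k ≤ k by omega), show k - (j - k) = 2 * k - j by omega,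
      ← mul_assoc, ← pow_add, show k + (2 * k - j) = j - k + 2 * (2 * k - j) by omega, pow_add,
      pow_mul]
    simp

/-- Eigenvectors of `pascalInvolution (2 * n) 0`, for the eigenvalue `1` in the first `n` rows and
for `-1` in the others. -/
noncomputable def pascalEigenrows (n : ℕ) (m : ℂ) : Matrix (Fin n ⊕ Fin n) (Fin (2 * n)) ℂ :=
  of <| Sum.elim (fun k j => shiftedCoeff (k : ℕ) j k) fun s j =>
    pascalWeight m j * (shiftedCoeff (m / 2 + (s : ℕ)) (2 * s + 1) j +
      shiftedCoeff (m / 2 + (s : ℕ) + 1) (2 * s + 1) j)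

theorem pascalEigenrows_mul_transpose {m : ℂ} (hm : ∀ k : ℕ, m ≠ -((k : ℂ) + 1)) (n : ℕ) :
    pascalEigenrows n m * (pascalInvolution (2 * n) 0)ᵀ =
      diagonal (Sum.elim (fun _ : Fin n => (1 : ℂ)) fun _ : Fin n => -1) * pascalEigenrows n m := by
  ext r i
  rw [diagonal_mul]
  have h0 : (pascalEigenrows n m * (pascalInvolution (2 * n) 0)ᵀ) r i =
      (pascalInvolution (2 * n) 0 *ᵥ pascalEigenrows n m r) i := by
    simp only [mul_apply, mulVec, dotProduct, transpose_apply, mul_comm]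
  rw [h0]
  rcases r with k | s
  · have h1 : pascalEigenrows n m (Sum.inl k) =
        ((-1 : ℂ) ^ (k : ℕ)) • fun j : Fin (2 * n) => shiftedCoeff (k : ℕ) (2 * k) j := by
      ext j
      simp [pascalEigenrows, shiftedCoeff_natCast_symm]
    have hk : 2 * (k : ℕ) < 2 * n := by omega
    rw [h1, mulVec_smul, pascalInvolution_mulVec_shiftedCoeff hk]
    simp only [Pi.smul_apply, Sum.elim_inl, one_mul, pow_mul]
    push_cast
    rw [show 2 * ((k : ℕ) : ℂ) + 0 - (k : ℕ) = (k : ℕ) by ring]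
    simp
  · have hs : 2 * (s : ℕ) + 1 < 2 * n := by omega
    -- The sum is an orbit of the reflection with `l = 2s + 1`, hence a `-1` eigenvector for
    -- parameter `m`; the weights carry it to parameter 0.
    have h1 : pascalEigenrows n m (Sum.inr s) =
        diagonal (fun j : Fin (2 * n) => pascalWeight m j) *ᵥ
          ((fun j : Fin (2 * n) => shiftedCoeff (m / 2 + (s : ℕ)) (2 * s + 1) j) +
            fun j : Fin (2 * n) => shiftedCoeff (m / 2 + (s : ℕ) + 1) (2 * s + 1) j) := by
      ext j
      simp [pascalEigenrows, mulVec_diagonal]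
    rw [h1, mulVec_mulVec, pascalInvolution_zero_mul_diagonal hm, ← mulVec_mulVec, mulVec_add,
      pascalInvolution_mulVec_shiftedCoeff hs, pascalInvolution_mulVec_shiftedCoeff hs,
      mulVec_diagonal, mulVec_diagonal]
    simp only [Pi.add_apply, Sum.elim_inr, pow_succ, pow_mul]
    push_cast
    rw [show 2 * ((s : ℕ) : ℂ) + 1 + m - (m / 2 + (s : ℕ)) = m / 2 + (s : ℕ) + 1 by ring,
      show 2 * ((s : ℕ) : ℂ) + 1 + m - (m / 2 + (s : ℕ) + 1) = m / 2 + (s : ℕ) by ring]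
    simp
    ring

/-- The pairing between the two halves of the rows of `pascalEigenrows n m`. -/
noncomputable def pascalPairing (n : ℕ) (m : ℂ) : Matrix (Fin n) (Fin n) ℂ :=
  of fun k s => shiftedCoeff ((k : ℕ) + (m / 2 + (s : ℕ))) (2 * s + 1) k +
    shiftedCoeff ((k : ℕ) + (m / 2 + (s : ℕ) + 1)) (2 * s + 1) k

theorem pascalEigenrows_mul_mul_transpose {m : ℂ} (hm : ∀ k : ℕ, m ≠ -((k : ℂ) + 1)) (n : ℕ) :
    pascalEigenrows n m * ((pascalInvolution (2 * n) 0)ᵀ - pascalInvolution (2 * n) m) *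
        diagonal (fun j : Fin (2 * n) => (pascalWeight m j)⁻¹) * (pascalEigenrows n m)ᵀ =
      fromBlocks 0 ((2 : ℂ) • pascalPairing n m) (-((2 : ℂ) • pascalPairing n m)ᵀ) 0 := by
  set U := pascalEigenrows n m with hU
  set ε : Fin n ⊕ Fin n → ℂ := Sum.elim (fun _ => 1) fun _ => -1 with hε
  set D := diagonal (fun j : Fin (2 * n) => pascalWeight m j) with hD
  set D' := diagonal (fun j : Fin (2 * n) => (pascalWeight m j)⁻¹) with hD'
  have hDD : D * D' = 1 := by
    rw [hD, hD', diagonal_mul_diagonal, ← diagonal_one]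
    congr 1
    ext j
    exact mul_inv_cancel₀ (pascalWeight_ne_zero hm j)
  have hDD' : D' * D = 1 := mul_eq_one_comm.1 hDD
  have hconj : pascalInvolution (2 * n) m * D' = D' * pascalInvolution (2 * n) 0 := by
    calc pascalInvolution (2 * n) m * D'
        = D' * (D * pascalInvolution (2 * n) m) * D' := by
          rw [← mul_assoc D', hDD', one_mul]
      _ = D' * pascalInvolution (2 * n) 0 := by
          rw [← pascalInvolution_zero_mul_diagonal hm, mul_assoc, mul_assoc, hDD, mul_one]
  have hrow := pascalEigenrows_mul_transpose hm n
  rw [← hU, ← hε] at hrow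
  have hcol : pascalInvolution (2 * n) 0 * Uᵀ = Uᵀ * diagonal ε := by
    have := congrArg transpose hrow
    rwa [transpose_mul, transpose_mul, transpose_transpose, diagonal_transpose] at this
  -- The weight built into the `-1` eigenvectors cancels the inverse weight of the form, leaving two
  -- Vandermonde sums.
  have hG : ∀ k s, (U * D' * Uᵀ) (Sum.inl k) (Sum.inr s) = pascalPairing n m k s := by
    intro k s
    have hs : 2 * (s : ℕ) + 1 < 2 * n := by omega
    rw [mul_apply, pascalPairing, of_apply, ← sum_shiftedCoeff_mul_shiftedCoeff hs,
      ← sum_shiftedCoeff_mul_shiftedCoeff hs, ← Finset.sum_add_distrib]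
    refine Finset.sum_congr rfl fun j _ => ?_
    have := pascalWeight_ne_zero hm j
    simp only [hD', mul_diagonal, transpose_apply, hU, pascalEigenrows, of_apply, Sum.elim_inl,
      Sum.elim_inr]
    field_simp
  have hGs : (U * D' * Uᵀ)ᵀ = U * D' * Uᵀ := by
    rw [transpose_mul, transpose_mul, transpose_transpose, hD', diagonal_transpose, Matrix.mul_assoc]
  -- A commutator with the diagonal of signs kills the blocks of equal eigenvalue and doubles the
  -- others up to sign.
  have hK : U * ((pascalInvolution (2 * n) 0)ᵀ - pascalInvolution (2 * n) m) * D' * Uᵀ =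
      diagonal ε * (U * D' * Uᵀ) - U * D' * Uᵀ * diagonal ε := by
    rw [Matrix.mul_sub, Matrix.sub_mul, Matrix.sub_mul, hrow, Matrix.mul_assoc U, hconj,
      Matrix.mul_assoc U (D' * _), Matrix.mul_assoc D', hcol]
    simp only [Matrix.mul_assoc]
  rw [hK]
  ext r c
  rw [Matrix.sub_apply, diagonal_mul, mul_diagonal]
  rcases r with k | k <;> rcases c with s | s
  · simp [hε]
  · rw [hG]
    simp [hε]
    ring
  · have : (U * D' * Uᵀ) (Sum.inr k) (Sum.inl s) = pascalPairing n m s k := by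
      rw [← hG, ← transpose_apply (U * D' * Uᵀ), hGs]
    rw [this]
    simp [hε]
    ring
  · simp [hε]

theorem pascalPairing_apply {m : ℂ} (hm : ∀ k : ℕ, m ≠ -((k : ℂ) + 1)) {n : ℕ} (k s : Fin n) :
    pascalPairing n m k s =
      Complex.Gamma (m / 2 + (s : ℕ) + 1) / ((2 * (s : ℕ) + 1).factorial : ℂ) *
        ((-1) ^ ((k : ℕ) + 1) * (m + 3 * (k : ℕ) + 1) / Complex.Gamma (m / 2 + 2 * (k : ℕ) + 1) *
          ((ascPochhammer ℂ k).eval (1 + m / 2 + (s : ℕ)) *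
            (ascPochhammer ℂ k).eval (1 + 2 * ((s : ℕ) : ℂ) - (k : ℕ) + 1) *
            (ascPochhammer ℂ s).eval (m / 2 + 2 * (k : ℕ) - (s : ℕ) + 1))) := by
  have hy : ∀ t : ℕ, m / 2 + t + 1 ≠ 0 := fun t ht =>
    hm (2 * t + 1) (by push_cast; linear_combination 2 * ht)
  rcases lt_or_ge (2 * (s : ℕ) + 1) k with h | h
  · have : (ascPochhammer ℂ k).eval (1 + 2 * ((s : ℕ) : ℂ) - (k : ℕ) + 1) = 0 := by
      rw [ascPochhammer_eval_eq_zero_iff]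
      refine ⟨(k : ℕ) - (2 * s + 2), by omega, ?_⟩
      rw [Nat.cast_sub (by omega)]
      push_cast
      ring
    rw [this, pascalPairing, of_apply, shiftedCoeff_of_lt h, shiftedCoeff_of_lt h]
    simp
  · obtain ⟨r, hr⟩ := Nat.exists_eq_add_of_le h
    have hrc : 2 * ((s : ℕ) : ℂ) + 1 = (k : ℕ) + r := by exact_mod_cast hr
    have hN : m / 2 + (s : ℕ) + (k : ℕ) + 1 ≠ 0 := by
      have := hy (s + k)
      push_cast [← add_assoc] at this
      exact this
    -- With `r = 2s + 1 - k`, adding the two adjacent binomials yields the linear factor `m + 3k +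
    -- 1`, which depends on the column only after transposition.
    have h1 := factorial_mul_choose_add_choose (m / 2 + 2 * (k : ℕ) - (s : ℕ)) r
    rw [show m / 2 + 2 * ((k : ℕ) : ℂ) - (s : ℕ) + r = m / 2 + (s : ℕ) + (k : ℕ) + 1 by
        linear_combination -hrc,
      show 2 * (m / 2 + 2 * ((k : ℕ) : ℂ) - (s : ℕ)) + r = m + 3 * (k : ℕ) + 1 by
        linear_combination -hrc, add_sub_cancel_right] at h1
    have h2 := ascPochhammer_eval_mul_Gamma_comm (z := m / 2 + 2 * (k : ℕ) - (s : ℕ) + 1) (r := r)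
      (s := (s : ℕ))
      (fun t ht => hy (s + k + 1 + t) (by push_cast; linear_combination ht + hrc))
      (fun t ht => hy (2 * k + t) (by push_cast; linear_combination ht))
    rw [show m / 2 + 2 * ((k : ℕ) : ℂ) - (s : ℕ) + 1 + (s : ℕ) = m / 2 + 2 * (k : ℕ) + 1 by ring,
      show m / 2 + 2 * ((k : ℕ) : ℂ) - (s : ℕ) + 1 + r = m / 2 + (s : ℕ) + (k : ℕ) + 1 + 1 by
        linear_combination -hrc, Complex.Gamma_add_one _ hN] at h2
    have h3 := Complex.Gamma_mul_ascPochhammer_eval (z := m / 2 + (s : ℕ) + 1) k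
      fun t ht => hy (s + t) (by push_cast; linear_combination ht)
    rw [show m / 2 + ((s : ℕ) : ℂ) + 1 + (k : ℕ) = m / 2 + (s : ℕ) + (k : ℕ) + 1 by ring] at h3
    have h4 : (r.factorial : ℂ) * (ascPochhammer ℂ k).eval ((r : ℂ) + 1) =
        ((2 * (s : ℕ) + 1).factorial : ℂ) := by
      have := Nat.factorial_mul_ascFactorial r k
      rw [← ascPochhammer_nat_eq_ascFactorial] at this
      rw [hr, add_comm (k : ℕ) r, ← this]
      push_cast [ascPochhammer_eval_cast]
      rfl
    have gk : Complex.Gamma (m / 2 + 2 * (k : ℕ) + 1) ≠ 0 :=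
      Complex.Gamma_ne_zero fun t ht => hy (2 * k + t) (by push_cast; linear_combination ht)
    have hf : (r.factorial : ℂ) ≠ 0 := Nat.cast_ne_zero.2 r.factorial_ne_zero
    have hF : ((2 * (s : ℕ) + 1).factorial : ℂ) ≠ 0 :=
      Nat.cast_ne_zero.2 (Nat.factorial_ne_zero _)
    have hsign : ((-1 : ℂ)) ^ r = (-1) ^ ((k : ℕ) + 1) := by
      have e : r + 2 * (k : ℕ) = (k : ℕ) + 1 + 2 * s := by omega
      have := congrArg (fun t => (-1 : ℂ) ^ t) e
      simpa [pow_add, pow_mul] using this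
    have hl : pascalPairing n m k s = (-1) ^ r *
        (Ring.choose (m / 2 + (s : ℕ) + (k : ℕ)) r +
          Ring.choose (m / 2 + (s : ℕ) + (k : ℕ) + 1) r) := by
      rw [pascalPairing, of_apply, hr, shiftedCoeff_add_left, shiftedCoeff_add_left, mul_add]
      congr 3 <;> ring
    rw [hl, hsign, show 1 + 2 * ((s : ℕ) : ℂ) - (k : ℕ) + 1 = r + 1 by linear_combination hrc,
      show 1 + m / 2 + ((s : ℕ) : ℂ) = m / 2 + (s : ℕ) + 1 by ring]
    generalize Ring.choose (m / 2 + ((s : ℕ) : ℂ) + (k : ℕ)) r +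
          Ring.choose (m / 2 + ((s : ℕ) : ℂ) + (k : ℕ) + 1) r = C at *
    generalize (ascPochhammer ℂ r).eval (m / 2 + 2 * ((k : ℕ) : ℂ) - (s : ℕ) + 1) = a₁ at *
    generalize (ascPochhammer ℂ s).eval (m / 2 + 2 * ((k : ℕ) : ℂ) - (s : ℕ) + 1) = a₂ at *
    generalize (ascPochhammer ℂ k).eval ((r : ℂ) + 1) = a₃ at *
    generalize (ascPochhammer ℂ k).eval (m / 2 + ((s : ℕ) : ℂ) + 1) = a₄ at *
    generalize Complex.Gamma (m / 2 + 2 * ((k : ℕ) : ℂ) + 1) = g₁ at *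
    generalize Complex.Gamma (m / 2 + ((s : ℕ) : ℂ) + 1) = g₂ at *
    generalize Complex.Gamma (m / 2 + ((s : ℕ) : ℂ) + (k : ℕ) + 1) = g₃ at *
    generalize m / 2 + ((s : ℕ) : ℂ) + (k : ℕ) + 1 = N at *
    generalize ((2 * (s : ℕ) + 1).factorial : ℂ) = F at *
    generalize (r.factorial : ℂ) = f at *
    have key : C * (g₁ * F) = g₂ * (m + 3 * (k : ℕ) + 1) * (a₄ * a₃ * a₂) := by
      apply mul_left_cancel₀ (mul_ne_zero hN hf)
      linear_combination g₁ * F * h1 + (m + 3 * (k : ℕ) + 1) * F * h2 -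
        N * (m + 3 * (k : ℕ) + 1) * a₂ * F * h3 -
        N * (m + 3 * (k : ℕ) + 1) * a₂ * (g₂ * a₄) * h4
    field_simp
    linear_combination key

theorem det_pascalPairing_sq {m : ℂ} (hm : ∀ k : ℕ, m ≠ -((k : ℂ) + 1)) (n : ℕ) :
    (pascalPairing n m).det ^ 2 = ∏ i ∈ Finset.range n,
      ((i.factorial : ℂ) * Complex.Gamma (m / 2 + i + 1) * Complex.Gamma (m / 2 + 3 * i + 2) *
        Complex.Gamma (m + 3 * i + 2) /
      (((2 * i + 1).factorial : ℂ) * Complex.Gamma (m / 2 + 2 * i + 1) *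
        Complex.Gamma (m / 2 + 2 * i + 2) * Complex.Gamma (m + 2 * i + 1))) ^ 2 := by
  have hentry : (pascalPairing n m)ᵀ = of fun s k : Fin n =>
      Complex.Gamma (m / 2 + (s : ℕ) + 1) / ((2 * (s : ℕ) + 1).factorial : ℂ) *
        (of fun s k : Fin n => (-1) ^ ((k : ℕ) + 1) * (m + 3 * (k : ℕ) + 1) /
            Complex.Gamma (m / 2 + 2 * (k : ℕ) + 1) *
          (of fun s k : Fin n => (ascPochhammer ℂ k).eval (1 + m / 2 + (s : ℕ)) *
            (ascPochhammer ℂ k).eval (1 + 2 * ((s : ℕ) : ℂ) - (k : ℕ) + 1) *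
            (ascPochhammer ℂ s).eval (m / 2 + 2 * (k : ℕ) - (s : ℕ) + 1)) s k) s k := by
    ext s k
    exact pascalPairing_apply hm k s
  -- The evaluation is used at `x = 1`, `y = m / 2`, with `s` as row index.
  rw [← det_transpose, hentry, det_mul_column, det_mul_row, det_ascPochhammer, Finset.prod_range,
    ← Finset.prod_mul_distrib, ← Finset.prod_mul_distrib, ← Finset.prod_pow, Finset.prod_range]
  refine Finset.prod_congr rfl fun ⟨i, _⟩ _ => ?_
  dsimp only
  have hy : ∀ t : ℕ, m / 2 + t + 1 ≠ 0 := fun t ht =>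
    hm (2 * t + 1) (by push_cast; linear_combination 2 * ht)
  have h1 := Complex.Gamma_mul_ascPochhammer_eval (z := m / 2 + 2 * i + 2) i
    fun t ht => hy (2 * i + 1 + t) (by push_cast; linear_combination ht)
  have h2 := Complex.Gamma_mul_ascPochhammer_eval (z := m + 2 * i + 1) i
    fun t ht => hm (2 * i + t) (by push_cast; linear_combination ht)
  rw [show m / 2 + 2 * (i : ℂ) + 2 + i = m / 2 + 3 * i + 2 by ring] at h1
  rw [show m + 2 * (i : ℂ) + 1 + i = m + 3 * i + 1 by ring] at h2
  have h3 := Complex.Gamma_add_one (m + 3 * i + 1)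
    fun ht => hm (3 * i) (by push_cast; linear_combination ht)
  rw [add_assoc (m + 3 * (i : ℂ)), one_add_one_eq_two, ← h2] at h3
  have g1 : Complex.Gamma (m / 2 + 2 * i + 2) ≠ 0 :=
    Complex.Gamma_ne_zero fun t ht => hy (2 * i + 1 + t) (by push_cast; linear_combination ht)
  have g2 : Complex.Gamma (m + 2 * i + 1) ≠ 0 :=
    Complex.Gamma_ne_zero fun t ht => hm (2 * i + t) (by push_cast; linear_combination ht)
  have hsq : ((-1 : ℂ) ^ (i + 1)) ^ 2 = 1 := by rw [← pow_mul, mul_comm, pow_mul]; simp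
  rw [h3, ← h1, show 2 * 1 + m / 2 + 2 * (i : ℂ) = m / 2 + 2 * i + 2 by ring,
    show 1 + 2 * (m / 2) + 2 * (i : ℂ) = m + 2 * i + 1 by ring]
  generalize Complex.Gamma (m / 2 + 2 * (i : ℂ) + 2) = G1 at *
  generalize Complex.Gamma (m + 2 * (i : ℂ) + 1) = G2 at *
  generalize Complex.Gamma (m / 2 + 2 * (i : ℂ) + 1) = G3
  generalize Complex.Gamma (m / 2 + (i : ℂ) + 1) = G4
  generalize (ascPochhammer ℂ i).eval (m / 2 + 2 * (i : ℂ) + 2) = a₁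
  generalize (ascPochhammer ℂ i).eval (m + 2 * (i : ℂ) + 1) = a₂
  generalize ((2 * i + 1).factorial : ℂ) = F
  have hR : (i.factorial : ℂ) * G4 * (G1 * a₁) * ((m + 3 * i + 1) * (G2 * a₂)) /
      (F * G3 * G1 * G2) = i.factorial * G4 * a₁ * (m + 3 * i + 1) * a₂ / (F * G3) := by
    rw [show (i.factorial : ℂ) * G4 * (G1 * a₁) * ((m + 3 * i + 1) * (G2 * a₂)) =
        i.factorial * G4 * a₁ * (m + 3 * i + 1) * a₂ * (G1 * G2) by ring,
      show F * G3 * G1 * G2 = F * G3 * (G1 * G2) by ring,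
      mul_div_mul_right _ _ (mul_ne_zero g1 g2)]
  rw [hR, show G4 / F * ((-1) ^ (i + 1) * (m + 3 * (i : ℂ) + 1) / G3 *
    (i.factorial * (a₁ * a₂))) = (-1) ^ (i + 1) *
      (i.factorial * G4 * a₁ * (m + 3 * i + 1) * a₂ / (F * G3)) by ring, mul_pow, hsq, one_mul]

/-! ### Determinant of the eigenbasis and assembly of the even case. -/

/-- The pairs `2 * k`, `2 * k + 1` with `k < n` exhaust the numbers below `2 * n`. -/
noncomputable def evenOddEquiv (n : ℕ) : Fin n ⊕ Fin n ≃ Fin (2 * n) :=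
  Equiv.ofBijective
    (Sum.elim (fun k => ⟨2 * k, by omega⟩) fun k => ⟨2 * k + 1, by omega⟩)
    ((Fintype.bijective_iff_injective_and_card _).2 ⟨by
      rintro (i | i) (j | j) h <;> simp [Fin.ext_iff] at h ⊢ <;> omega, by
      simp [two_mul]⟩)

theorem evenOddEquiv_inl_val {n : ℕ} (k : Fin n) :
    (evenOddEquiv n (Sum.inl k) : ℕ) = 2 * k := rfl

theorem evenOddEquiv_inr_val {n : ℕ} (k : Fin n) :
    (evenOddEquiv n (Sum.inr k) : ℕ) = 2 * k + 1 := rfl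

theorem prod_univ_fin_two_mul (n : ℕ) (f : ℕ → ℂ) :
    ∏ j : Fin (2 * n), f j = ∏ k ∈ Finset.range n, f (2 * k) * f (2 * k + 1) := by
  rw [← (evenOddEquiv n).prod_comp, Fintype.prod_sum_type, Finset.prod_range,
    ← Finset.prod_mul_distrib]
  rfl

/-- The last nonzero entries of the two kinds of rows lie in columns `2k` and `2k + 1`, so
interleaving the rows makes the matrix lower triangular. -/
theorem det_pascalEigenrows_sq (n : ℕ) (m : ℂ) :
    ((pascalEigenrows n m).submatrix (evenOddEquiv n).symm id).det ^ 2 =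
      ∏ i ∈ Finset.range n, (2 * pascalWeight m (2 * i + 1)) ^ 2 := by
  rw [det_of_isLowerTriangular]
  · rw [← (evenOddEquiv n).prod_comp, Fintype.prod_sum_type, mul_pow]
    have h1 : ∀ k : Fin n, (pascalEigenrows n m).submatrix (evenOddEquiv n).symm id
        (evenOddEquiv n (Sum.inl k)) (evenOddEquiv n (Sum.inl k)) = (-1) ^ (k : ℕ) := by
      intro k
      simp only [submatrix_apply, Equiv.symm_apply_apply, id, pascalEigenrows, of_apply,
        Sum.elim_inl, evenOddEquiv_inl_val]
      rw [shiftedCoeff_natCast_symm, shiftedCoeff_self, mul_one]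
    have h2 : ∀ k : Fin n, (pascalEigenrows n m).submatrix (evenOddEquiv n).symm id
        (evenOddEquiv n (Sum.inr k)) (evenOddEquiv n (Sum.inr k)) =
          2 * pascalWeight m (2 * k + 1) := by
      intro k
      simp only [submatrix_apply, Equiv.symm_apply_apply, id, pascalEigenrows, of_apply,
        Sum.elim_inr, evenOddEquiv_inr_val]
      rw [shiftedCoeff_self, shiftedCoeff_self]
      ring
    simp only [h1, h2]
    rw [sq (∏ i : Fin n, _), prod_neg_one_pow_sq, one_mul, ← Finset.prod_pow, Finset.prod_range]
  · intro i j hij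
    have hij : (i : ℕ) < j := hij
    obtain ⟨r, rfl⟩ := (evenOddEquiv n).surjective i
    rcases r with k | k
    · rw [evenOddEquiv_inl_val] at hij
      simp only [submatrix_apply, Equiv.symm_apply_apply, id, pascalEigenrows, of_apply,
        Sum.elim_inl]
      rw [shiftedCoeff_natCast_symm, shiftedCoeff_of_lt hij, mul_zero]
    · rw [evenOddEquiv_inr_val] at hij
      simp only [submatrix_apply, Equiv.symm_apply_apply, id, pascalEigenrows, of_apply,
        Sum.elim_inr]
      rw [shiftedCoeff_of_lt hij, shiftedCoeff_of_lt hij, add_zero, mul_zero]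

theorem det_sub_pascalInvolution_of_even {m : ℂ} (hm : ∀ k : ℕ, m ≠ -((k : ℂ) + 1)) (n : ℕ) :
    det ((pascalInvolution (2 * n) 0)ᵀ - pascalInvolution (2 * n) m) =
      (pascalPairing n m).det ^ 2 *
        ∏ i ∈ Finset.range n, pascalWeight m (2 * i) / pascalWeight m (2 * i + 1) := by
  set J := (pascalInvolution (2 * n) 0)ᵀ - pascalInvolution (2 * n) m with hJ
  set U := pascalEigenrows n m with hU
  set D' := diagonal (fun j : Fin (2 * n) => (pascalWeight m j)⁻¹) with hD'
  have h := pascalEigenrows_mul_mul_transpose hm n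
  rw [← hJ, ← hU, ← hD'] at h
  have h1 : (U * J * D' * Uᵀ).submatrix (evenOddEquiv n).symm (evenOddEquiv n).symm =
      U.submatrix (evenOddEquiv n).symm id * J * D' * (U.submatrix (evenOddEquiv n).symm id)ᵀ := rfl
  have h2 := congrArg det h1
  rw [det_submatrix_equiv_self, h, det_mul, det_mul, det_mul, det_transpose,
    det_fromBlocks_zero_neg_transpose, det_smul, Fintype.card_fin, hD', det_diagonal,
    prod_univ_fin_two_mul n fun j => (pascalWeight m j)⁻¹] at h2
  have h3 := det_pascalEigenrows_sq n m
  rw [← hU] at h3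
  -- This product is the squared determinant of the eigenbasis times the determinant of the inverse
  -- weights. Its factor `4 ^ n` cancels against the 2 in front of the pairing.
  have hne : ∏ i ∈ Finset.range n,
      4 * (pascalWeight m (2 * i + 1) / pascalWeight m (2 * i)) ≠ 0 :=
    Finset.prod_ne_zero_iff.2 fun i _ => mul_ne_zero (by norm_num)
      (div_ne_zero (pascalWeight_ne_zero hm _) (pascalWeight_ne_zero hm _))
  apply mul_right_cancel₀ hne
  have h4 : (∏ i ∈ Finset.range n, (2 * pascalWeight m (2 * i + 1)) ^ 2) *
      (∏ i ∈ Finset.range n, (pascalWeight m (2 * i))⁻¹ * (pascalWeight m (2 * i + 1))⁻¹) =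
      ∏ i ∈ Finset.range n, 4 * (pascalWeight m (2 * i + 1) / pascalWeight m (2 * i)) := by
    rw [← Finset.prod_mul_distrib]
    refine Finset.prod_congr rfl fun i _ => ?_
    have a := pascalWeight_ne_zero hm (2 * i)
    have b := pascalWeight_ne_zero hm (2 * i + 1)
    field_simp
    norm_num
  have h5 : (∏ i ∈ Finset.range n, pascalWeight m (2 * i) / pascalWeight m (2 * i + 1)) *
      ∏ i ∈ Finset.range n, 4 * (pascalWeight m (2 * i + 1) / pascalWeight m (2 * i)) =
      4 ^ n := by
    rw [← Finset.prod_mul_distrib, ← Finset.card_range n, ← Finset.prod_const, Finset.card_range]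
    refine Finset.prod_congr rfl fun i _ => ?_
    have a := pascalWeight_ne_zero hm (2 * i)
    have b := pascalWeight_ne_zero hm (2 * i + 1)
    field_simp
  have h6 : (4 : ℂ) ^ n = (2 ^ n) ^ 2 := by rw [← pow_mul, mul_comm n, pow_mul]; norm_num
  rw [mul_assoc, h5, h6, ← h4, ← h3]
  linear_combination -h2

theorem mainTheorem5 (a : ℕ) (m : ℂ) :
    (Odd a →
      Matrix.det (Matrix.of fun i j : Fin a =>
        -(if i = j then (1 : ℂ) else 0) +
          Ring.choose (m + ((i : ℕ) : ℂ) + ((j : ℕ) : ℂ)) (j : ℕ)) = 0) ∧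
    (Even a → (∀ k : ℕ, m ≠ -((k : ℂ) + 1)) →
      Matrix.det (Matrix.of fun i j : Fin a =>
        -(if i = j then (1 : ℂ) else 0) +
          Ring.choose (m + ((i : ℕ) : ℂ) + ((j : ℕ) : ℂ)) (j : ℕ)) =
        (-1 : ℂ) ^ (a / 2) *
          ∏ i ∈ Finset.range (a / 2),
            ((Nat.factorial i : ℂ) ^ 2 *
              complexFactorial (m / 2 + (i : ℂ)) ^ 2 *
              complexFactorial (m / 2 + 3 * (i : ℂ) + 1) ^ 2 *
              complexFactorial (m + 3 * (i : ℂ) + 1) ^ 2) /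
            ((Nat.factorial (2 * i) : ℂ) *
              (Nat.factorial (2 * i + 1) : ℂ) *
              complexFactorial (m / 2 + 2 * (i : ℂ)) ^ 2 *
              complexFactorial (m / 2 + 2 * (i : ℂ) + 1) ^ 2 *
              complexFactorial (m + 2 * (i : ℂ)) *
              complexFactorial (m + 2 * (i : ℂ) + 1))) := by
  refine ⟨fun ha => ?_, fun ha hm => ?_⟩
  · rw [det_neg_one_add_choose, det_sub_pascalInvolution_of_odd ha, zero_mul]
  · obtain ⟨n, rfl⟩ := ha.exists_two_nsmul
    rw [smul_eq_mul, det_neg_one_add_choose, det_sub_pascalInvolution_of_even hm,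
      det_pascalPairing_sq hm, Nat.mul_div_cancel_left n two_pos,
      prod_univ_fin_two_mul n fun j => (-1 : ℂ) ^ j, ← Finset.prod_mul_distrib, mul_comm]
    congr 1
    -- Each pair of indices `2k`, `2k + 1` contributes a factor `-1`.
    · rw [← Finset.card_range n, ← Finset.prod_const, Finset.card_range]
      exact Finset.prod_congr rfl fun k _ => by simp [pow_succ, pow_mul]
    · refine Finset.prod_congr rfl fun i _ => ?_
      have hw : ∀ j : ℕ, Complex.Gamma (m + j + 1) ≠ 0 := fun j =>
        Complex.Gamma_ne_zero fun k hk => hm (j + k) (by push_cast; linear_combination hk)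
      have w0 := hw (2 * i)
      have w1 := hw (2 * i + 1)
      have f0 : ((2 * i).factorial : ℂ) ≠ 0 := Nat.cast_ne_zero.2 (Nat.factorial_ne_zero _)
      have f1 : ((2 * i + 1).factorial : ℂ) ≠ 0 := Nat.cast_ne_zero.2 (Nat.factorial_ne_zero _)
      simp only [complexFactorial, pascalWeight]
      push_cast [← add_assoc] at w0 w1 ⊢
      simp only [add_assoc _ (1 : ℂ) 1, one_add_one_eq_two] at w0 w1 ⊢
      have hy : ∀ j : ℕ, Complex.Gamma (m / 2 + j + 1) ≠ 0 := fun j =>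
        Complex.Gamma_ne_zero fun k hk =>
          hm (2 * (j + k) + 1) (by push_cast; linear_combination 2 * hk)
      have y0 := hy (2 * i)
      have y1 := hy (2 * i + 1)
      push_cast [← add_assoc] at y0 y1
      simp only [add_assoc _ (1 : ℂ) 1, one_add_one_eq_two] at y1
      generalize Complex.Gamma (m / 2 + 2 * (i : ℂ) + 1) = G1 at *
      generalize Complex.Gamma (m / 2 + 2 * (i : ℂ) + 2) = G2 at *
      generalize Complex.Gamma (m + 2 * (i : ℂ) + 1) = G3 at *
      generalize Complex.Gamma (m + 2 * (i : ℂ) + 2) = G4 at *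
      field_simp
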